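/- For $t>0$ and $f:\mathbb{Z}^d\to\mathbb{C}$ let $$\mathcal{M}_t^{B^1} f(x)=\frac{1}{|(t\cdot B^1)\cap\mathbb{Z}^d|}\sum_{y\in (t\cdot B^1)\cap\mathbb{Z}^d} f(x-y),\qquad x\in\mathbb{Z}^d,$$ where $B^1=\{x\in\mathbb{R}^d:\sum_{i=1}^d|x_i|\le 1\}$ and $t\cdot B^1=\{tx : x\in B^1\}$, and let $\mathbb{D}=\{2^n:n=0,1,2,\dots\}$. Then for every real $p\in[2,\infty)$, every integer $d\ge 4$ and every $f\in l^p(\mathbb{Z}^d)$, the function $x\mapsto\sup_{t\in\mathbb{D},\,t\le\sqrt d}|\mathcal{M}_t^{B^1}f(x)|$ belongs to $l^p(\mathbb{Z}^d)$ and $$\Big\|\sup_{t\in\mathbb{D},\ t\le\sqrt d}|\mathcal{M}_t^{B^1}f|\Big\|_{l^p(\mathbb{Z}^d)}\le 30^{4/p}\,\|f\|_{l^p(\mathbb{Z}^d)}.$$ -/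

import Mathlib

open scoped ENNReal Pointwise

noncomputable section

/-- The closed unit ball of the `l¹` norm in `ℝ^d`. -/
def l1UnitBall (d : ℕ) : Set (Fin d → ℝ) :=
  {x | ∑ i, |x i| ≤ 1}

/-- The set `(t · B¹) ∩ ℤ^d`, as a set of integer vectors. -/
def dilateLatticePoints (d : ℕ) (t : ℝ) : Set (Fin d → ℤ) :=
  {y | (fun i => (y i : ℝ)) ∈ t • l1UnitBall d}

theorem dilateLatticePoints_finite (d : ℕ) (t : ℝ) : (dilateLatticePoints d t).Finite := by
  refine (Set.finite_Icc (fun _ : Fin d => -⌈|t|⌉) (fun _ => ⌈|t|⌉)).subset ?_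
  rintro y ⟨x, hx, hxy⟩
  have key : ∀ i, |y i| ≤ ⌈|t|⌉ := by
    intro i
    have h1 : (y i : ℝ) = t * x i := (congrFun hxy i).symm
    have h2 : |x i| ≤ 1 :=
      (Finset.single_le_sum (f := fun i => |x i|) (fun j _ => abs_nonneg (x j))
        (Finset.mem_univ i)).trans hx
    have h3 : |(y i : ℝ)| ≤ |t| := by
      rw [h1, abs_mul]
      exact mul_le_of_le_one_right (abs_nonneg t) h2
    exact_mod_cast h3.trans (Int.le_ceil |t|)
  exact ⟨fun i => (abs_le.mp (key i)).1, fun i => (abs_le.mp (key i)).2⟩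

/-- The finite set `(t · B¹) ∩ ℤ^d`. -/
def l1BallPoints (d : ℕ) (t : ℝ) : Finset (Fin d → ℤ) :=
  (dilateLatticePoints_finite d t).toFinset

/-- The discrete Hardy-Littlewood averaging operator `𝓜_t` over `(t · B¹) ∩ ℤ^d`. -/
def l1Average (d : ℕ) (t : ℝ) (f : (Fin d → ℤ) → ℂ) (x : Fin d → ℤ) : ℂ :=
  ((l1BallPoints d t).card : ℂ)⁻¹ * ∑ y ∈ l1BallPoints d t, f (x - y)

/-- The dyadic integers `2^n`, `n = 0, 1, 2, …`, as real numbers. -/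
def dyadicIntegers : Set ℝ :=
  {t | ∃ n : ℕ, t = 2 ^ n}

/-- The maximal function `sup |𝓜_t f|` over dyadic `t ≤ √d`. For `d ≥ 1` this is the supremum
of a finite non-empty family. -/
def smallDyadicMaximal (d : ℕ) (f : (Fin d → ℤ) → ℂ) (x : Fin d → ℤ) : ℝ :=
  ⨆ t : {t : ℝ // t ∈ dyadicIntegers ∧ t ≤ √(d : ℝ)}, ‖l1Average d t f x‖

end

/-! The averages over all balls of integer radius `N` with `N ^ 2 ≤ d` are dominated by powers of
one symmetric random walk, whose maximal function is bounded on `ℓ²` independently of `d`. The walk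
picks a coordinate and a sign uniformly and jumps `k + 1` units with weight proportional to `a ^ k`,
where `a = 2 / (3√d)`. A point `y` of the ball with `j` non-zero coordinates is reached in `j` steps
in `j!` orders. Since the ball has at least `(2d)^N / (2 N!)` points, its uniform density at `y` is
at most `6 (3/4)^(N - j)` times the `j`-step kernel (`inv_card_l1BallPoints_le`). Summing over `j`
costs a factor 4, so the average is at most 24 times the maximal function of the walk
(`average_l1BallPoints_le`). That maximal function has `ℓ²` norm at most 4, by Stein's theorem
(`exists_even_pow_le_norm_le`), used for even and for odd powers. For `p ≥ 2`, Jensen's inequality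
reduces `ℓ^p` to `ℓ²` applied to `|f|^(p/2)`. -/

/-! ### Maximal theorem for powers of a symmetric contraction -/

open Finset in
/-- A Hilbert space form of Rota's dilation: the kernel `λ ^ (2 * max i j) - λ ^ (2 * i + 2 * j)` is
positive semidefinite for `λ ∈ [-1, 1]`, and the same holds for a symmetric contraction. -/
theorem norm_sq_sum_even_pow_le {E : Type*} [NormedAddCommGroup E] [InnerProductSpace ℝ E]
    {T : E →ₗ[ℝ] E} (hT : T.IsSymmetric) (hc : ∀ x, ‖T x‖ ≤ ‖x‖) (n : ℕ) (h : ℕ → E) :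
    ‖∑ i ∈ range n, (T ^ (2 * i)) (h i)‖ ^ 2 ≤
      ∑ i ∈ range n, ∑ j ∈ range n, inner ℝ ((T ^ (2 * max i j)) (h i)) (h j) := by
  induction n generalizing h with
  | zero => simp
  | succ n ih =>
    have hpow : ∀ k x, (T ^ (2 * (k + 1))) x = T ((T ^ (2 * k)) (T x)) := by
      intro k x
      rw [show 2 * (k + 1) = (2 * k + 1) + 1 by ring, pow_succ', pow_succ]
      rfl
    -- Splitting off `h 0` leaves `T w`. On the right, indices `≥ 1` give the same form for `T (h (i
    -- + 1))`, as one `T` moves to each side; the cross terms match exactly, and `‖T w‖ ≤ ‖w‖`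
    -- closes the induction.
    set w := ∑ i ∈ range n, (T ^ (2 * i)) (T (h (i + 1))) with hw
    have hsum : ∑ i ∈ range (n + 1), (T ^ (2 * i)) (h i) = T w + h 0 := by
      rw [sum_range_succ', hw, map_sum]
      simp [hpow]
    have h1 : ∑ i ∈ range n, ∑ j ∈ range n,
        inner ℝ ((T ^ (2 * max (i + 1) (j + 1))) (h (i + 1))) (h (j + 1)) =
        ∑ i ∈ range n, ∑ j ∈ range n,
          inner ℝ ((T ^ (2 * max i j)) (T (h (i + 1)))) (T (h (j + 1))) := by
      refine sum_congr rfl fun i _ => sum_congr rfl fun j _ => ?_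
      rw [show max (i + 1) (j + 1) = max i j + 1 by omega, hpow, hT]
    have h2 : ∑ i ∈ range n, inner ℝ ((T ^ (2 * (i + 1))) (h (i + 1))) (h 0) =
        inner ℝ (T w) (h 0) := by
      rw [← sum_inner, hw, map_sum]
      simp [hpow]
    have h3 : ∑ j ∈ range n, inner ℝ ((T ^ (2 * (j + 1))) (h 0)) (h (j + 1)) =
        inner ℝ (T w) (h 0) := by
      rw [← h2]
      refine sum_congr rfl fun j _ => ?_
      rw [(hT.pow _) _ _, real_inner_comm]
    have h4 := ih fun i => T (h (i + 1))
    have h5 : ‖T w‖ ^ 2 ≤ ‖w‖ ^ 2 := by gcongr; exact hc w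
    rw [hsum, norm_add_sq_real, sum_range_succ']
    simp only [sum_range_succ', sum_add_distrib, h1]
    simp only [Nat.max_zero, Nat.zero_max, max_self, mul_zero, pow_zero, Module.End.one_apply,
      h2, h3, real_inner_self_eq_norm_sq]
    rw [← hw] at h4
    linarith

open Finset in
/-- **Stein's maximal theorem** in `ℓ²`, for the even powers of a positive symmetric contraction. -/
theorem exists_even_pow_le_norm_le {α : Type*}
    {T : lp (fun _ : α => ℝ) 2 →ₗ[ℝ] lp (fun _ : α => ℝ) 2}
    (hT : T.IsSymmetric) (hc : ∀ f, ‖T f‖ ≤ ‖f‖)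
    (hpos : ∀ f : lp (fun _ : α => ℝ) 2, (∀ x, 0 ≤ f x) → ∀ x, 0 ≤ T f x)
    {f : lp (fun _ : α => ℝ) 2} (hf : ∀ x, 0 ≤ f x) (n : ℕ) :
    ∃ F : lp (fun _ : α => ℝ) 2,
      (∀ i ≤ n, ∀ x, (T ^ (2 * i)) f x ≤ F x) ∧ ‖F‖ ≤ 2 * ‖f‖ := by
  classical
  have hpow : ∀ k (g : lp (fun _ : α => ℝ) 2), (∀ x, 0 ≤ g x) → ∀ x, 0 ≤ (T ^ k) g x := by
    intro k
    induction k with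
    | zero => intro g hg x; simpa using hg x
    | succ k ih => intro g hg x; rw [pow_succ]; exact ih _ (hpos g hg) x
  -- Linearise the supremum by choosing a maximising index `m x`; `h i` is then `T ^ (2 * i) f` cut
  -- off to `{m = i}`.
  have hmax : ∀ x, ∃ m ∈ range (n + 1), ∀ i ∈ range (n + 1),
      (T ^ (2 * i)) f x ≤ (T ^ (2 * m)) f x := fun x =>
    exists_max_image _ _ ⟨0, by simp⟩
  choose m hm hmle using hmax
  let h : ℕ → lp (fun _ : α => ℝ) 2 := fun i =>
    ⟨fun x => if m x = i then (T ^ (2 * i)) f x else 0, by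
      refine (lp.memℓp ((T ^ (2 * i)) f)).mono' fun x => ?_
      split_ifs <;> simp⟩
  have happ : ∀ i x, h i x = if m x = i then (T ^ (2 * i)) f x else 0 := fun _ _ => rfl
  have hh0 : ∀ i x, 0 ≤ h i x := by
    intro i x
    rw [happ]
    split_ifs
    exacts [hpow _ _ hf x, le_rfl]
  let F := ∑ i ∈ range (n + 1), h i
  have hF : ∀ x, F x = (T ^ (2 * m x)) f x := by
    intro x
    simp only [F, lp.coeFn_sum, Finset.sum_apply, happ]
    rw [sum_ite_eq, if_pos (hm x)]
  refine ⟨F, fun i hi x => ?_, ?_⟩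
  · rw [hF]; exact hmle x i (by simpa [Nat.lt_succ_iff] using hi)
  have hinner : ∀ u v : lp (fun _ : α => ℝ) 2, (∀ x, 0 ≤ u x) → (∀ x, 0 ≤ v x) →
      0 ≤ inner ℝ u v := by
    intro u v hu hv
    rw [lp.inner_eq_tsum]
    exact tsum_nonneg fun x => by simpa using mul_nonneg (hv x) (hu x)
  -- `w` is the adjoint of the linearised operator `g ↦ T ^ (2 * m x) g x`, applied to `F`. Hence
  -- `‖F‖ ^ 2 = ⟪f, w⟫`, and it remains to bound `‖w‖` by `2 * ‖F‖`.
  let w := ∑ i ∈ range (n + 1), (T ^ (2 * i)) (h i)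
  have hw : ‖w‖ ^ 2 ≤ 2 * inner ℝ w F := by
    refine (norm_sq_sum_even_pow_le hT hc (n + 1) h).trans ?_
    have e1 : ∑ i ∈ range (n + 1), ∑ j ∈ range (n + 1),
        inner ℝ ((T ^ (2 * i)) (h i)) (h j) = inner ℝ w F := by
      simp only [w, F, sum_inner, inner_sum]
      exact sum_comm
    have e2 : ∑ i ∈ range (n + 1), ∑ j ∈ range (n + 1),
        inner ℝ ((T ^ (2 * j)) (h i)) (h j) = inner ℝ w F := by
      rw [← e1, sum_comm]
      refine sum_congr rfl fun i _ => sum_congr rfl fun j _ => ?_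
      rw [(hT.pow _) _ _, real_inner_comm]
    rw [two_mul]
    nth_rw 1 [← e1]
    rw [← e2, ← sum_add_distrib]
    refine sum_le_sum fun i _ => ?_
    rw [← sum_add_distrib]
    refine sum_le_sum fun j _ => ?_
    have p1 := hinner _ _ (hpow (2 * i) _ (hh0 i)) (hh0 j)
    have p2 := hinner _ _ (hpow (2 * j) _ (hh0 i)) (hh0 j)
    -- The maximum is `i` or `j`, and positivity allows the other term to be added.
    rcases max_choice i j with e | e <;> rw [e] <;> linarith
  have hw2 : ‖w‖ ≤ 2 * ‖F‖ := by
    have := real_inner_le_norm w F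
    by_contra! hlt
    nlinarith [norm_nonneg w, norm_nonneg F]
  have hFF : ‖F‖ ^ 2 = inner ℝ f w := by
    rw [← real_inner_self_eq_norm_sq]
    simp only [w, inner_sum]
    conv_lhs => rw [show inner ℝ F F = inner ℝ F (∑ i ∈ range (n + 1), h i) from rfl, inner_sum]
    refine sum_congr rfl fun i _ => ?_
    rw [← (hT.pow _) _ _, lp.inner_eq_tsum, lp.inner_eq_tsum]
    refine tsum_congr fun x => ?_
    rw [hF, happ]
    split_ifs with hx
    · rw [hx]
    · simp
  have := real_inner_le_norm f w
  by_contra! hlt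
  nlinarith [norm_nonneg w, norm_nonneg F, norm_nonneg f,
    mul_le_mul_of_nonneg_left hw2 (norm_nonneg f)]

/-! ### Random walks on an abelian group -/

/-- The weighted average `x ↦ ∑ i, w i * f (x - v i)` over finitely many steps `v i`. -/
def stepAverage {G ι : Type*} [AddCommGroup G] [Fintype ι] (w : ι → ℝ) (v : ι → G)
    (f : G → ℝ) : G → ℝ :=
  fun x => ∑ i, w i * f (x - v i)

theorem stepAverage_nonneg {G ι : Type*} [AddCommGroup G] [Fintype ι] {w : ι → ℝ}
    (hw : ∀ i, 0 ≤ w i) (v : ι → G) {f : G → ℝ} (hf : ∀ x, 0 ≤ f x) (x : G) :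
    0 ≤ stepAverage w v f x :=
  Finset.sum_nonneg fun i _ => mul_nonneg (hw i) (hf _)

theorem iterate_stepAverage_nonneg {G ι : Type*} [AddCommGroup G] [Fintype ι] {w : ι → ℝ}
    (hw : ∀ i, 0 ≤ w i) (v : ι → G) {f : G → ℝ} (hf : ∀ x, 0 ≤ f x) (n : ℕ) (x : G) :
    0 ≤ (stepAverage w v)^[n] f x := by
  induction n generalizing x with
  | zero => exact hf x
  | succ n ih =>
    rw [Function.iterate_succ_apply']
    exact stepAverage_nonneg hw v ih x

/-- The kernel of `(stepAverage w v)^[n]` is its value at the point mass at `0`. -/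
theorem sum_kernel_mul_le_iterate_stepAverage {G ι : Type*} [AddCommGroup G] [DecidableEq G]
    [Fintype ι] {w : ι → ℝ} (hw : ∀ i, 0 ≤ w i) (v : ι → G) {f : G → ℝ} (hf : ∀ x, 0 ≤ f x)
    (n : ℕ) (s : Finset G) (x : G) :
    ∑ y ∈ s, (stepAverage w v)^[n] (Pi.single 0 1) y * f (x - y) ≤
      (stepAverage w v)^[n] f x := by
  induction n generalizing s x with
  | zero =>
    simp only [Function.iterate_zero, id, Pi.single_apply, ite_mul, one_mul, zero_mul]
    rw [Finset.sum_ite_eq']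
    split_ifs
    · simp
    · exact hf x
  | succ n ih =>
    simp only [Function.iterate_succ_apply']
    calc _ = ∑ i, w i * ∑ y ∈ s.map (Equiv.subRight (v i)).toEmbedding,
          (stepAverage w v)^[n] (Pi.single 0 1) y * f (x - v i - y) := by
          simp only [stepAverage, Finset.sum_mul, Finset.mul_sum, Finset.sum_map]
          rw [Finset.sum_comm]
          refine Finset.sum_congr rfl fun i _ => Finset.sum_congr rfl fun y _ => ?_
          rw [Equiv.coe_toEmbedding, Equiv.subRight_apply, sub_sub_sub_cancel_right, mul_assoc]
      _ ≤ _ := Finset.sum_le_sum fun i _ => mul_le_mul_of_nonneg_left (ih _ _) (hw i)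

/-- Translation by `v` on `ℓ²(G)`. -/
noncomputable def lpTranslate {G : Type*} [AddCommGroup G] (v : G) :
    lp (fun _ : G => ℝ) 2 →ₗ[ℝ] lp (fun _ : G => ℝ) 2 where
  toFun f := ⟨fun x => f (x - v), by
    have h := (memℓp_gen_iff (by norm_num)).1 (lp.memℓp f)
    exact (memℓp_gen_iff (by norm_num)).2 ((Equiv.subRight v).summable_iff.2 h)⟩
  map_add' _ _ := rfl
  map_smul' _ _ := rfl

theorem lpTranslate_apply {G : Type*} [AddCommGroup G] (v : G) (f : lp (fun _ : G => ℝ) 2)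
    (x : G) : lpTranslate v f x = f (x - v) := rfl

theorem norm_lpTranslate {G : Type*} [AddCommGroup G] (v : G) (f : lp (fun _ : G => ℝ) 2) :
    ‖lpTranslate v f‖ = ‖f‖ := by
  rw [lp.norm_eq_tsum_rpow (by norm_num), lp.norm_eq_tsum_rpow (by norm_num)]
  congr 1
  exact (Equiv.subRight v).tsum_eq fun x => ‖f x‖ ^ (2 : ℝ≥0∞).toReal

theorem inner_lpTranslate {G : Type*} [AddCommGroup G] (v : G) (f g : lp (fun _ : G => ℝ) 2) :
    inner ℝ (lpTranslate v f) g = inner ℝ f (lpTranslate (-v) g) := by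
  rw [lp.inner_eq_tsum, lp.inner_eq_tsum, ← (Equiv.addRight v).tsum_eq]
  refine tsum_congr fun x => ?_
  simp [lpTranslate_apply]

/-- The operator `stepAverage w v` on `ℓ²(G)`. -/
noncomputable def lpStepAverage {G ι : Type*} [AddCommGroup G] [Fintype ι] (w : ι → ℝ)
    (v : ι → G) : lp (fun _ : G => ℝ) 2 →ₗ[ℝ] lp (fun _ : G => ℝ) 2 :=
  ∑ i, w i • lpTranslate (v i)

theorem coe_lpStepAverage {G ι : Type*} [AddCommGroup G] [Fintype ι] (w : ι → ℝ)
    (v : ι → G) (f : lp (fun _ : G => ℝ) 2) :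
    ⇑(lpStepAverage w v f) = stepAverage w v f := by
  ext x
  rw [lpStepAverage, LinearMap.sum_apply, lp.coeFn_sum, Finset.sum_apply]
  rfl

theorem coe_lpStepAverage_pow {G ι : Type*} [AddCommGroup G] [Fintype ι] (w : ι → ℝ)
    (v : ι → G) (n : ℕ) (f : lp (fun _ : G => ℝ) 2) :
    ⇑((lpStepAverage w v ^ n) f) = (stepAverage w v)^[n] f := by
  induction n with
  | zero => rfl
  | succ n ih =>
    rw [Function.iterate_succ_apply', ← ih, ← coe_lpStepAverage, pow_succ']
    rfl

theorem norm_lpStepAverage_le {G ι : Type*} [AddCommGroup G] [Fintype ι] {w : ι → ℝ}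
    (hw : ∀ i, 0 ≤ w i) (hw1 : ∑ i, w i ≤ 1) (v : ι → G) (f : lp (fun _ : G => ℝ) 2) :
    ‖lpStepAverage w v f‖ ≤ ‖f‖ := by
  rw [lpStepAverage, LinearMap.sum_apply]
  calc _ ≤ ∑ i, w i * ‖f‖ := by
        refine norm_sum_le_of_le _ fun i _ => ?_
        rw [LinearMap.smul_apply, norm_smul, norm_lpTranslate, Real.norm_of_nonneg (hw i)]
    _ = (∑ i, w i) * ‖f‖ := by rw [Finset.sum_mul]
    _ ≤ ‖f‖ := mul_le_of_le_one_left (norm_nonneg _) hw1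

theorem isSymmetric_lpStepAverage {G ι : Type*} [AddCommGroup G] [Fintype ι] {w : ι → ℝ}
    {v : ι → G} (e : ι ≃ ι) (hw : ∀ i, w (e i) = w i) (hv : ∀ i, v (e i) = -v i) :
    (lpStepAverage w v).IsSymmetric := by
  intro f g
  simp only [lpStepAverage, LinearMap.sum_apply, LinearMap.smul_apply, sum_inner, inner_sum,
    real_inner_smul_left, real_inner_smul_right]
  rw [← e.sum_comp]
  exact Finset.sum_congr rfl fun i _ => by rw [hw, hv, inner_lpTranslate, neg_neg]

/-- The maximal function of the powers of a symmetric random walk is bounded on `ℓ²`. -/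
theorem exists_iterate_stepAverage_le_norm_le {G ι : Type*} [AddCommGroup G] [Fintype ι]
    {w : ι → ℝ} {v : ι → G} (hw0 : ∀ i, 0 ≤ w i) (hw1 : ∑ i, w i ≤ 1)
    (e : ι ≃ ι) (hw : ∀ i, w (e i) = w i) (hv : ∀ i, v (e i) = -v i)
    {f : lp (fun _ : G => ℝ) 2} (hf : ∀ x, 0 ≤ f x) (n : ℕ) :
    ∃ F : lp (fun _ : G => ℝ) 2,
      (∀ i ≤ n, ∀ x, (stepAverage w v)^[i] f x ≤ F x) ∧ ‖F‖ ≤ 4 * ‖f‖ := by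
  have hT := isSymmetric_lpStepAverage e hw hv
  have hc := norm_lpStepAverage_le hw0 hw1 v
  have hpos : ∀ g : lp (fun _ : G => ℝ) 2, (∀ x, 0 ≤ g x) → ∀ x, 0 ≤ lpStepAverage w v g x := by
    intro g hg x
    rw [coe_lpStepAverage]
    exact stepAverage_nonneg hw0 v hg x
  obtain ⟨F₀, hF₀, hn₀⟩ := exists_even_pow_le_norm_le hT hc hpos hf n
  obtain ⟨F₁, hF₁, hn₁⟩ := exists_even_pow_le_norm_le hT hc hpos (hpos f hf) n
  have h0 : ∀ x, 0 ≤ F₀ x := fun x => (hf x).trans (by simpa using hF₀ 0 n.zero_le x)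
  have h1 : ∀ x, 0 ≤ F₁ x := fun x => (hpos f hf x).trans (by simpa using hF₁ 0 n.zero_le x)
  refine ⟨F₀ + F₁, fun i hi x => ?_, ?_⟩
  · rw [lp.coeFn_add, Pi.add_apply, ← coe_lpStepAverage_pow]
    -- Odd powers of `f` are even powers of `T f`.
    obtain ⟨k, rfl | rfl⟩ := i.even_or_odd'
    · linarith [hF₀ k (by omega) x, h1 x]
    · have := hF₁ k (by omega) x
      rw [pow_succ]
      change (lpStepAverage w v ^ (2 * k)) (lpStepAverage w v f) x ≤ _
      linarith [h0 x]
  · linarith [norm_add_le F₀ F₁, hc f]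

/-! ### Counting lattice points of small balls -/

theorem natCast_mem_l1BallPoints {d N : ℕ} (hN : 0 < N) {y : Fin d → ℤ} :
    y ∈ l1BallPoints d N ↔ ∑ i, (y i).natAbs ≤ N := by
  have hN' : (0 : ℝ) < N := by exact_mod_cast hN
  have key : ∑ i, |(N : ℝ)⁻¹ * (y i : ℝ)| ≤ 1 ↔ ∑ i, (y i).natAbs ≤ N := by
    simp only [abs_mul, abs_inv, Nat.abs_cast]
    rw [← Finset.mul_sum, inv_mul_le_iff₀ hN', mul_one]
    have : ∑ i, |(y i : ℝ)| = ((∑ i, (y i).natAbs : ℕ) : ℝ) := by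
      push_cast
      exact Finset.sum_congr rfl fun i _ => by rw [Nat.cast_natAbs, Int.cast_abs]
    rw [this, Nat.cast_le]
  rw [← key, l1BallPoints, Set.Finite.mem_toFinset, dilateLatticePoints, Set.mem_ofPred_eq,
    Set.mem_smul_set_iff_inv_smul_mem₀ hN'.ne']
  rfl

/-- Count only the vectors with entries in `{0, 1, -1}` and exactly `N` non-zero entries, encoded by
the support and the subset of negative entries. -/
theorem choose_mul_two_pow_le_card_l1BallPoints {d N : ℕ} (hN : 0 < N) :
    d.choose N * 2 ^ N ≤ (l1BallPoints d N).card := by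
  classical
  let A := (Finset.powersetCard N (Finset.univ : Finset (Fin d))).sigma fun s => s.powerset
  have hA : A.card = d.choose N * 2 ^ N := by
    rw [Finset.card_sigma, Finset.sum_congr rfl fun s hs => by
      rw [Finset.card_powerset, (Finset.mem_powersetCard.1 hs).2], Finset.sum_const,
      Finset.card_powersetCard, Finset.card_univ, Fintype.card_fin, smul_eq_mul]
  rw [← hA]
  refine Finset.card_le_card_of_injOn
    (fun q i => if i ∈ q.1 then (if i ∈ q.2 then -1 else 1) else 0) ?_ ?_
  · rintro ⟨s, u⟩ hq
    simp only [A, Finset.coe_sigma, Set.mem_sigma_iff, Finset.mem_coe,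
      Finset.mem_powersetCard] at hq
    simp only [Finset.mem_coe]
    rw [natCast_mem_l1BallPoints hN, ← hq.1.2, Finset.card_eq_sum_ones,
      ← Finset.sum_subset (Finset.subset_univ s)]
    · exact Finset.sum_le_sum fun i hi => by simp only [hi, if_true]; split_ifs <;> simp
    · intro i _ hi
      simp [hi]
  · rintro ⟨s, u⟩ hq ⟨s', u'⟩ hq' h
    simp only [A, Finset.coe_sigma, Set.mem_sigma_iff, Finset.mem_coe,
      Finset.mem_powerset] at hq hq'
    have h1 : ∀ i, (i ∈ s ↔ i ∈ s') ∧ (i ∈ u ↔ i ∈ u') := by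
      intro i
      have hi := congrFun h i
      have hu := @hq.2 i
      have hu' := @hq'.2 i
      by_cases a1 : i ∈ s <;> by_cases a2 : i ∈ s' <;> by_cases a3 : i ∈ u <;>
        by_cases a4 : i ∈ u' <;> simp_all
    obtain rfl : s = s' := Finset.ext fun i => (h1 i).1
    obtain rfl : u = u' := Finset.ext fun i => (h1 i).2
    rfl

/-- This is `∏ (1 - k/d) ≥ 1 - ∑ k/d` over `k < n`. -/
theorem pow_mul_one_sub_le_descFactorial {d : ℕ} (hd : 0 < d) {n : ℕ} (hn : n ≤ d) :
    (d : ℝ) ^ n * (1 - n * (n - 1) / (2 * d)) ≤ d.descFactorial n := by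
  induction n with
  | zero => simp
  | succ n ih =>
    have hd' : (0 : ℝ) < d := by exact_mod_cast hd
    have hn' : (0 : ℝ) ≤ d - n := by
      rw [sub_nonneg]; exact_mod_cast (by omega : n ≤ d)
    have hnn : (0 : ℝ) ≤ n * n * (n - 1) := by
      rcases n with _ | n
      · simp
      · push_cast; rw [add_sub_cancel_right]; positivity
    rw [Nat.descFactorial_succ, Nat.cast_mul, Nat.cast_sub (by omega)]
    refine le_trans ?_ (mul_le_mul_of_nonneg_left (ih (by omega)) hn')
    have : (d - n : ℝ) * (d ^ n * (1 - n * (n - 1) / (2 * d))) -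
        d ^ (n + 1) * (1 - ((n + 1 : ℕ) : ℝ) * ((n + 1 : ℕ) - 1) / (2 * d)) =
        d ^ n * (n * n * (n - 1)) / (2 * d) := by
      push_cast; field_simp; ring
    have h2 : 0 ≤ (d : ℝ) ^ n * (n * n * (n - 1)) / (2 * d) := by positivity
    linarith

theorem two_mul_pow_le_card_l1BallPoints {d N : ℕ} (hN : 0 < N) (hNd : N ^ 2 ≤ d) :
    (2 * d : ℝ) ^ N ≤ 2 * N.factorial * (l1BallPoints d N).card := by
  have hd : 0 < d := lt_of_lt_of_le (by positivity) hNd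
  have hd' : (0 : ℝ) < d := by exact_mod_cast hd
  have hNd' : (N : ℝ) ^ 2 ≤ d := by exact_mod_cast hNd
  have h1 := pow_mul_one_sub_le_descFactorial hd (by nlinarith : N ≤ d)
  have h2 : (d.descFactorial N : ℝ) = N.factorial * d.choose N := by
    exact_mod_cast Nat.descFactorial_eq_factorial_mul_choose d N
  have h3 : (d.choose N : ℝ) * 2 ^ N ≤ (l1BallPoints d N).card := by
    exact_mod_cast choose_mul_two_pow_le_card_l1BallPoints hN
  have h4 : (N : ℝ) * (N - 1) / (2 * d) ≤ 1 / 2 := by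
    rw [div_le_div_iff₀ (by positivity) (by norm_num)]
    nlinarith [(Nat.cast_nonneg N : (0 : ℝ) ≤ N)]
  have h5 : (d : ℝ) ^ N * (1 / 2) ≤ N.factorial * d.choose N := by
    rw [← h2]
    refine le_trans ?_ h1
    gcongr
    linarith
  calc (2 * d : ℝ) ^ N = 2 * 2 ^ N * ((d : ℝ) ^ N * (1 / 2)) := by rw [mul_pow]; ring
    _ ≤ 2 * 2 ^ N * (N.factorial * d.choose N) := by gcongr
    _ = 2 * N.factorial * (d.choose N * 2 ^ N) := by ring
    _ ≤ _ := by gcongr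

/-! ### The axis-parallel walk and domination of the averages -/

/-- The axis-parallel step `± (k + 1) e_i`. -/
def axisStep {d : ℕ} (q : Fin d × Fin d × Bool) : Fin d → ℤ :=
  Pi.single q.1 (if q.2.2 then (q.2.1 : ℤ) + 1 else -((q.2.1 : ℤ) + 1))

/-- The truncated geometric weight of the step `± (k + 1) e_i`. -/
noncomputable def axisWeight {d : ℕ} (a : ℝ) (q : Fin d × Fin d × Bool) : ℝ :=
  (1 - a) / (2 * d) * a ^ (q.2.1 : ℕ)

theorem axisWeight_nonneg {d : ℕ} {a : ℝ} (ha0 : 0 ≤ a) (ha1 : a ≤ 1)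
    (q : Fin d × Fin d × Bool) : 0 ≤ axisWeight a q := by
  have : 0 ≤ 1 - a := by linarith
  unfold axisWeight
  positivity

theorem sum_axisWeight_le_one {d : ℕ} {a : ℝ} (ha0 : 0 ≤ a) :
    ∑ q : Fin d × Fin d × Bool, axisWeight a q ≤ 1 := by
  rcases Nat.eq_zero_or_pos d with rfl | hd
  · simp
  have hd' : (0 : ℝ) < d := by exact_mod_cast hd
  have h : ∑ q : Fin d × Fin d × Bool, axisWeight a q = (1 - a) * ∑ k ∈ Finset.range d, a ^ k := by
    simp only [axisWeight, Fintype.sum_prod_type, Finset.sum_const, Finset.card_univ,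
      Fintype.card_bool, Fintype.card_fin, nsmul_eq_mul, ← Finset.mul_sum]
    rw [Fin.sum_univ_eq_sum_range (fun k => a ^ k)]
    field_simp
    push_cast
    ring
  rw [h, mul_neg_geom_sum]
  linarith [pow_nonneg ha0 d]

/-- After as many steps as `y` has non-zero coordinates, the walk can reach `y` by making these
coordinates right one after the other, in any order. -/
theorem factorial_mul_le_iterate_stepAverage_axis {d : ℕ} {a : ℝ} (ha0 : 0 ≤ a) (ha1 : a ≤ 1)
    {n : ℕ} {y : Fin d → ℤ} (hy : ∀ i, (y i).natAbs ≤ d)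
    (hn : (Finset.univ.filter fun i => y i ≠ 0).card = n) :
    n.factorial * ((1 - a) / (2 * d)) ^ n * ∏ i, a ^ ((y i).natAbs - 1) ≤
      (stepAverage (axisWeight a) axisStep)^[n] (Pi.single 0 1) y := by
  have hw := axisWeight_nonneg (d := d) ha0 ha1
  induction n generalizing y with
  | zero =>
    have : y = 0 := by
      ext i
      by_contra h
      have := Finset.card_eq_zero.1 hn
      exact Finset.notMem_empty i (this ▸ Finset.mem_filter.2 ⟨Finset.mem_univ i, h⟩)
    subst this
    simp
  | succ n ih =>
    have hδ : ∀ x : Fin d → ℤ, 0 ≤ (Pi.single 0 1 : (Fin d → ℤ) → ℝ) x := by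
      intro x
      rw [Pi.single_apply]
      split_ifs <;> norm_num
    have hκ := iterate_stepAverage_nonneg hw axisStep hδ n
    rw [Function.iterate_succ_apply']
    set S := Finset.univ.filter fun i => y i ≠ 0 with hS
    set P := ∏ i, a ^ ((y i).natAbs - 1) with hP
    -- Each of the `n + 1` non-zero coordinates may be the one set by the last step, with the same
    -- lower bound for each.
    calc ((n + 1).factorial : ℝ) * ((1 - a) / (2 * d)) ^ (n + 1) * P
        = ∑ i ∈ S, (n.factorial * ((1 - a) / (2 * d)) ^ (n + 1) * P) := by
          rw [Finset.sum_const, hn, nsmul_eq_mul, Nat.factorial_succ]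
          push_cast
          ring
      _ ≤ ∑ i ∈ S, ∑ q : Fin d × Bool, axisWeight a (i, q) *
            (stepAverage (axisWeight a) axisStep)^[n] (Pi.single 0 1) (y - axisStep (i, q)) := by
          refine Finset.sum_le_sum fun i hi => ?_
          have hyi : y i ≠ 0 := (Finset.mem_filter.1 hi).2
          have hlt : (y i).natAbs - 1 < d := by have := hy i; omega
          let q : Fin d × Bool := (⟨(y i).natAbs - 1, hlt⟩, decide (0 < y i))
          have hupd : y - axisStep (i, q) = Function.update y i 0 := by
            ext l
            by_cases hl : l = i
            · subst hl
              simp only [axisStep, q, Pi.sub_apply, Pi.single_eq_same, Function.update_self,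
                decide_eq_true_eq]
              split_ifs <;> omega
            · simp [axisStep, hl]
          have hcard : (Finset.univ.filter fun l => Function.update y i 0 l ≠ 0).card = n := by
            have : (Finset.univ.filter fun l => Function.update y i 0 l ≠ 0) = S.erase i := by
              ext l
              by_cases hl : l = i
              · subst hl; simp
              · simp [hl, hS]
            rw [this, Finset.card_erase_of_mem hi, hn, Nat.add_sub_cancel]
          have hle : ∀ l, (Function.update y i 0 l).natAbs ≤ d := by
            intro l
            by_cases hl : l = i
            · subst hl; simp
            · simpa [hl] using hy l
          -- Truncated subtraction makes the factor of a zero coordinate `a ^ 0 = 1`.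
          have hprod : a ^ ((y i).natAbs - 1) *
              ∏ l, a ^ ((Function.update y i 0 l).natAbs - 1) = P := by
            rw [hP, ← Finset.mul_prod_erase _ _ (Finset.mem_univ i),
              ← Finset.mul_prod_erase _ (fun l => a ^ ((y l).natAbs - 1)) (Finset.mem_univ i)]
            rw [Finset.prod_congr rfl fun l hl => by
              rw [Function.update_of_ne (Finset.ne_of_mem_erase hl)]]
            simp
          refine le_trans ?_ (Finset.single_le_sum
            (f := fun q => axisWeight a (i, q) * (stepAverage (axisWeight a) axisStep)^[n]
              (Pi.single 0 1) (y - axisStep (i, q)))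
            (fun q _ => mul_nonneg (hw _) (hκ _)) (Finset.mem_univ q))
          refine ((le_of_eq ?_).trans
            (mul_le_mul_of_nonneg_left (ih hle hcard) (hw (i, q)))).trans
            (le_of_eq (by simp only [hupd]))
          rw [← hprod]
          simp only [axisWeight, q]
          ring
      _ ≤ ∑ i, ∑ q : Fin d × Bool, axisWeight a (i, q) *
            (stepAverage (axisWeight a) axisStep)^[n] (Pi.single 0 1) (y - axisStep (i, q)) :=
          Finset.sum_le_sum_of_subset_of_nonneg (Finset.subset_univ _) fun i _ _ =>
            Finset.sum_nonneg fun q _ => mul_nonneg (hw _) (hκ _)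
      _ = _ := by rw [stepAverage, Fintype.sum_prod_type]

/-- Take `j` to be the number of non-zero coordinates of `y`. The factor 6 is 2 from the point count
times 3 from `(1 - a) ^ j ≥ 1 - N a ≥ 1/3`; the decay comes from `N / (2d) ≤ √d / (2d) = 3a/4`. -/
theorem inv_card_l1BallPoints_le {d N : ℕ} (hN : 0 < N) (hNd : N ^ 2 ≤ d) {y : Fin d → ℤ}
    (hy : y ∈ l1BallPoints d N) :
    ∃ j ≤ N, ((l1BallPoints d N).card : ℝ)⁻¹ ≤ 6 * (3 / 4) ^ (N - j) *
      (stepAverage (axisWeight (2 / (3 * √d))) axisStep)^[j] (Pi.single 0 1) y := by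
  rw [natCast_mem_l1BallPoints hN] at hy
  have hd : 0 < d := lt_of_lt_of_le (by positivity) hNd
  have hd' : (0 : ℝ) < d := by exact_mod_cast hd
  have hs : (0 : ℝ) < √d := Real.sqrt_pos.2 hd'
  have hss : √(d : ℝ) * √d = d := Real.mul_self_sqrt hd'.le
  have hNs : (N : ℝ) ≤ √d := Real.le_sqrt_of_sq_le (by exact_mod_cast hNd)
  have hN1 : (1 : ℝ) ≤ N := by exact_mod_cast hN
  have hNN : N ≤ d := by nlinarith
  set a : ℝ := 2 / (3 * √d) with ha
  have ha0 : 0 < a := by positivity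
  have haN : N * a ≤ 2 / 3 := by
    rw [ha, mul_div_assoc', div_le_div_iff₀ (by positivity) (by norm_num)]
    linarith
  have ha1 : a ≤ 2 / 3 := by nlinarith
  set S := Finset.univ.filter fun i => y i ≠ 0
  have hsum : ∑ i, ((y i).natAbs - 1) + S.card = ∑ i, (y i).natAbs := by
    rw [Finset.card_filter, ← Finset.sum_add_distrib]
    refine Finset.sum_congr rfl fun i _ => ?_
    split_ifs <;> omega
  set j := S.card with hj
  have hjN : j ≤ N := by omega
  refine ⟨j, hjN, ?_⟩
  have hle : ∀ i, (y i).natAbs ≤ d := fun i =>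
    ((Finset.single_le_sum (fun i _ => Nat.zero_le _) (Finset.mem_univ i)).trans hy).trans hNN
  have hκ := factorial_mul_le_iterate_stepAverage_axis ha0.le (by linarith : a ≤ 1) hle hj.symm
  rw [Finset.prod_pow_eq_pow_sum] at hκ
  have hpow : a ^ (N - j) ≤ a ^ ∑ i, ((y i).natAbs - 1) :=
    pow_le_pow_of_le_one ha0.le (by linarith) (by omega)
  have hbern : 1 / 3 ≤ (1 - a) ^ j := by
    have h1 := one_add_mul_le_pow (by linarith : (-2 : ℝ) ≤ -a) j
    have h2 : (j : ℝ) * a ≤ N * a := by gcongr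
    rw [← sub_eq_add_neg] at h1
    linarith
  have hfac : (N.factorial : ℝ) ≤ j.factorial * (N : ℝ) ^ (N - j) := by
    have h1 := Nat.factorial_mul_descFactorial (Nat.sub_le N j)
    rw [Nat.sub_sub_self hjN] at h1
    rw [← h1]
    push_cast
    gcongr
    exact_mod_cast Nat.descFactorial_le_pow N (N - j)
  have hcard := two_mul_pow_le_card_l1BallPoints hN hNd
  have hcpos : (0 : ℝ) < (l1BallPoints d N).card := by
    by_contra! h
    have : (0 : ℝ) < (2 * d) ^ N := by positivity
    nlinarith [(Nat.cast_nonneg N.factorial : (0 : ℝ) ≤ N.factorial)]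
  have hr : 2 * d * (3 / 4 * a) = √d := by
    rw [ha]
    field_simp
    linarith
  calc ((l1BallPoints d N).card : ℝ)⁻¹ ≤ 2 * N.factorial / (2 * d) ^ N := by
        rw [inv_eq_one_div, div_le_div_iff₀ hcpos (by positivity)]
        linarith
    _ ≤ 2 * (j.factorial * √d ^ (N - j)) / (2 * d) ^ N := by
        gcongr
        exact hfac.trans (by gcongr)
    _ = 6 * (3 / 4) ^ (N - j) * (j.factorial * (1 / 3 / (2 * d) ^ j) * a ^ (N - j)) := by
        have e : (2 * d : ℝ) ^ N = (2 * d) ^ j * (2 * d) ^ (N - j) := by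
          rw [← pow_add, Nat.add_sub_of_le hjN]
        rw [← hr, mul_pow, mul_pow, e]
        field_simp
        ring_nf
    _ ≤ 6 * (3 / 4) ^ (N - j) *
          (j.factorial * ((1 - a) / (2 * d)) ^ j * a ^ ∑ i, ((y i).natAbs - 1)) := by
        have h1a : 0 ≤ 1 - a := by linarith
        rw [div_pow (1 - a)]
        gcongr
    _ ≤ _ := by gcongr

/-- Averages over small balls are dominated by the powers of a single random walk. -/
theorem average_l1BallPoints_le {d N : ℕ} (hN : 0 < N) (hNd : N ^ 2 ≤ d)
    {f : (Fin d → ℤ) → ℝ} (hf : ∀ x, 0 ≤ f x) {x : Fin d → ℤ} {C : ℝ}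
    (hC : ∀ j ≤ N, (stepAverage (axisWeight (2 / (3 * √d))) axisStep)^[j] f x ≤ C) :
    ∑ y ∈ l1BallPoints d N, ((l1BallPoints d N).card : ℝ)⁻¹ * f (x - y) ≤ 24 * C := by
  have hd : 0 < d := lt_of_lt_of_le (by positivity) hNd
  have hs : 1 ≤ √(d : ℝ) := Real.one_le_sqrt.2 (by exact_mod_cast hd)
  have ha0 : 0 ≤ 2 / (3 * √(d : ℝ)) := by positivity
  have ha1 : 2 / (3 * √(d : ℝ)) ≤ 1 := by
    rw [div_le_one (by positivity)]
    linarith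
  have hw := axisWeight_nonneg (d := d) ha0 ha1
  have hC0 : 0 ≤ C := (hf x).trans (hC 0 N.zero_le)
  set T := stepAverage (axisWeight (d := d) (2 / (3 * √d))) axisStep
  have hκ : ∀ j y, 0 ≤ T^[j] (Pi.single 0 1) y := fun j =>
    iterate_stepAverage_nonneg hw axisStep (fun z => by
      rw [Pi.single_apply]; split_ifs <;> norm_num) j
  have hgeom : ∑ j ∈ Finset.range (N + 1), (3 / 4 : ℝ) ^ (N - j) ≤ 4 := by
    have h := Finset.sum_range_reflect (fun k => (3 / 4 : ℝ) ^ k) (N + 1)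
    simp only [Nat.add_sub_cancel] at h
    rw [h, geom_sum_eq (by norm_num)]
    have : (0 : ℝ) ≤ (3 / 4) ^ (N + 1) := by positivity
    rw [div_le_iff_of_neg (by norm_num)]
    linarith
  calc _ ≤ ∑ y ∈ l1BallPoints d N, (∑ j ∈ Finset.range (N + 1),
          6 * (3 / 4) ^ (N - j) * T^[j] (Pi.single 0 1) y) * f (x - y) := by
        refine Finset.sum_le_sum fun y hy => mul_le_mul_of_nonneg_right ?_ (hf _)
        obtain ⟨j, hj, h⟩ := inv_card_l1BallPoints_le hN hNd hy
        refine h.trans (Finset.single_le_sum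
          (f := fun j => 6 * (3 / 4) ^ (N - j) * T^[j] (Pi.single 0 1) y) (fun i _ => ?_)
          (Finset.mem_range.2 (by omega)))
        exact mul_nonneg (by positivity) (hκ i y)
    _ = ∑ j ∈ Finset.range (N + 1), 6 * (3 / 4) ^ (N - j) *
          ∑ y ∈ l1BallPoints d N, T^[j] (Pi.single 0 1) y * f (x - y) := by
        simp only [Finset.sum_mul, Finset.mul_sum, mul_assoc]
        rw [Finset.sum_comm]
    _ ≤ ∑ j ∈ Finset.range (N + 1), 6 * (3 / 4) ^ (N - j) * C := by
        refine Finset.sum_le_sum fun j hj => mul_le_mul_of_nonneg_left ?_ (by positivity)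
        exact (sum_kernel_mul_le_iterate_stepAverage hw axisStep hf j _ x).trans
          (hC j (by simpa [Nat.lt_succ_iff] using hj))
    _ = 6 * C * ∑ j ∈ Finset.range (N + 1), (3 / 4 : ℝ) ^ (N - j) := by
        rw [Finset.mul_sum]
        exact Finset.sum_congr rfl fun _ _ => by ring
    _ ≤ 6 * C * 4 := by gcongr
    _ = 24 * C := by ring

/-- The `ℓ²` maximal inequality, with domination by a single function on all small balls. -/
theorem exists_average_l1BallPoints_le_norm_le {d : ℕ} (hd : 0 < d)
    {f : lp (fun _ : Fin d → ℤ => ℝ) 2} (hf : ∀ x, 0 ≤ f x) :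
    ∃ F : lp (fun _ : Fin d → ℤ => ℝ) 2,
      (∀ N : ℕ, 0 < N → N ^ 2 ≤ d → ∀ x, ∑ y ∈ l1BallPoints d N,
        ((l1BallPoints d N).card : ℝ)⁻¹ * f (x - y) ≤ 24 * F x) ∧ ‖F‖ ≤ 4 * ‖f‖ := by
  have hs : 1 ≤ √(d : ℝ) := Real.one_le_sqrt.2 (by exact_mod_cast hd)
  have ha0 : 0 ≤ 2 / (3 * √(d : ℝ)) := by positivity
  have ha1 : 2 / (3 * √(d : ℝ)) ≤ 1 := by
    rw [div_le_one (by positivity)]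
    linarith
  obtain ⟨F, hF, hn⟩ := exists_iterate_stepAverage_le_norm_le
    (axisWeight_nonneg (d := d) ha0 ha1) (sum_axisWeight_le_one ha0) (v := axisStep)
    ((Equiv.refl _).prodCongr ((Equiv.refl _).prodCongr Equiv.boolNot)) (fun _ => rfl)
    (by rintro ⟨i, k, b⟩; cases b <;> simp [axisStep, ← Pi.single_neg]) hf d
  -- Powers up to `d` suffice, since `j ≤ N ≤ N ^ 2 ≤ d`.
  refine ⟨F, fun N hN hNd x => average_l1BallPoints_le hN hNd hf fun j hj => hF j ?_ x, hn⟩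
  nlinarith

/-! ### Reduction from `ℓ^p` to `ℓ²` -/

theorem norm_l1Average_rpow_le {d : ℕ} {t : ℝ} (ht : (l1BallPoints d t).Nonempty)
    (f : (Fin d → ℤ) → ℂ) (x : Fin d → ℤ) {q : ℝ} (hq : 1 ≤ q) :
    ‖l1Average d t f x‖ ^ q ≤
      ∑ y ∈ l1BallPoints d t, ((l1BallPoints d t).card : ℝ)⁻¹ * ‖f (x - y)‖ ^ q := by
  have hc : ((l1BallPoints d t).card : ℝ) ≠ 0 := by exact_mod_cast ht.card_ne_zero
  have h1 : ‖l1Average d t f x‖ ≤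
      ∑ y ∈ l1BallPoints d t, ((l1BallPoints d t).card : ℝ)⁻¹ * ‖f (x - y)‖ := by
    rw [l1Average, norm_mul, norm_inv, Complex.norm_natCast, ← Finset.mul_sum]
    gcongr
    exact norm_sum_le _ _
  refine (Real.rpow_le_rpow (norm_nonneg _) h1 (by linarith)).trans ?_
  refine Real.rpow_arith_mean_le_arith_mean_rpow _ _ _ (fun _ _ => by positivity) ?_
    (fun _ _ => norm_nonneg _) hq
  rw [Finset.sum_const, nsmul_eq_mul, mul_inv_cancel₀ hc]

theorem smallDyadicMaximal_nonneg (d : ℕ) (f : (Fin d → ℤ) → ℂ) (x : Fin d → ℤ) :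
    0 ≤ smallDyadicMaximal d f x :=
  Real.iSup_nonneg fun _ => norm_nonneg _

theorem smallDyadicMaximal_rpow_le {d : ℕ} {f : (Fin d → ℤ) → ℂ} {x : Fin d → ℤ} {q C : ℝ}
    (hq : 1 ≤ q) (hC0 : 0 ≤ C)
    (hC : ∀ N : ℕ, 0 < N → N ^ 2 ≤ d → ∑ y ∈ l1BallPoints d N,
      ((l1BallPoints d N).card : ℝ)⁻¹ * ‖f (x - y)‖ ^ q ≤ C) :
    smallDyadicMaximal d f x ^ q ≤ C := by
  have hq0 : 0 < q := by linarith
  rw [← Real.le_rpow_inv_iff_of_pos (smallDyadicMaximal_nonneg d f x) hC0 hq0]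
  refine Real.iSup_le ?_ (by positivity)
  rintro ⟨t, ⟨n, rfl⟩, ht⟩
  rw [Real.le_rpow_inv_iff_of_pos (norm_nonneg _) hC0 hq0]
  have hcast : (2 : ℝ) ^ n = ((2 ^ n : ℕ) : ℝ) := by push_cast; rfl
  have hN : 0 < 2 ^ n := by positivity
  have hNd : (2 ^ n) ^ 2 ≤ d := by
    have := (Real.le_sqrt (by positivity) (by positivity)).1 ht
    exact_mod_cast this
  simp only [hcast]
  refine (norm_l1Average_rpow_le ⟨0, ?_⟩ f x hq).trans (hC _ hN hNd)
  rw [natCast_mem_l1BallPoints hN]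
  simp

theorem theorem1p1 (p : ℝ) (hp : 2 ≤ p) (d : ℕ) (hd : 4 ≤ d)
    (f : lp (fun _ : Fin d → ℤ => ℂ) (ENNReal.ofReal p)) :
    ∃ h : Memℓp (smallDyadicMaximal d (fun x => f x)) (ENNReal.ofReal p),
      ‖(⟨smallDyadicMaximal d (fun x => f x), h⟩ :
          lp (fun _ : Fin d → ℤ => ℝ) (ENNReal.ofReal p))‖
        ≤ (30 : ℝ) ^ (4 / p) * ‖f‖ := by
  have hp0 : 0 < p := by linarith
  have hpr : (ENNReal.ofReal p).toReal = p := ENNReal.toReal_ofReal hp0.le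
  have hpp : 0 < (ENNReal.ofReal p).toReal := by rwa [hpr]
  have hfn : 0 ≤ ‖f‖ := lp.norm_nonneg' f
  have hf := lp.hasSum_norm hpp f
  rw [hpr] at hf
  have hsq : ∀ u : ℝ, 0 ≤ u → (u ^ (p / 2)) ^ 2 = u ^ p := by
    intro u hu
    rw [← Real.rpow_natCast, ← Real.rpow_mul hu]
    congr 1
    push_cast
    ring
  have hg : Memℓp (fun x : Fin d → ℤ => ‖f x‖ ^ (p / 2)) 2 := by
    refine memℓp_gen (hf.summable.congr fun x => ?_)
    rw [ENNReal.toReal_ofNat, Real.rpow_ofNat, Real.norm_of_nonneg (by positivity),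
      hsq _ (norm_nonneg _)]
  let g : lp (fun _ : Fin d → ℤ => ℝ) 2 := ⟨_, hg⟩
  have hg_apply : ∀ x, g x = ‖f x‖ ^ (p / 2) := fun _ => rfl
  have hgn : ‖g‖ ^ 2 = ‖f‖ ^ p := by
    have h := lp.hasSum_norm (by norm_num) g
    simp only [ENNReal.toReal_ofNat, Real.rpow_ofNat] at h
    refine h.unique (hf.congr_fun fun x => ?_)
    rw [hg_apply, Real.norm_of_nonneg (by positivity), hsq _ (norm_nonneg _)]
  obtain ⟨F, hF, hFn⟩ := exists_average_l1BallPoints_le_norm_le (by omega : 0 < d) (f := g)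
    fun x => by rw [hg_apply]; positivity
  have hFsum := lp.hasSum_norm (by norm_num) F
  simp only [ENNReal.toReal_ofNat, Real.rpow_ofNat, Real.norm_eq_abs, sq_abs] at hFsum
  have hF0 : ∀ x, 0 ≤ F x := by
    intro x
    -- `F` is non-negative because it dominates, up to the factor 24, the average of `g ≥ 0` over
    -- the ball of radius 1.
    have h1 := hF 1 one_pos (by omega) x
    have h2 : 0 ≤ ∑ y ∈ l1BallPoints d (1 : ℕ),
        ((l1BallPoints d (1 : ℕ)).card : ℝ)⁻¹ * g (x - y) :=
      Finset.sum_nonneg fun y _ => by rw [hg_apply]; positivity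
    linarith
  have hmax : ∀ x, ‖smallDyadicMaximal d (fun x => f x) x‖ ^ p ≤ 576 * F x ^ 2 := by
    intro x
    have h0 := smallDyadicMaximal_nonneg d (fun x => f x) x
    have h1 := smallDyadicMaximal_rpow_le (f := fun x => f x) (x := x) (q := p / 2)
      (by linarith) (mul_nonneg (by norm_num : (0 : ℝ) ≤ 24) (hF0 x))
      fun N hN hNd => hF N hN hNd x
    rw [Real.norm_of_nonneg h0, ← hsq _ h0]
    calc _ ≤ (24 * F x) ^ 2 := by gcongr
      _ = _ := by ring
  have hsum : Summable fun x => ‖smallDyadicMaximal d (fun x => f x) x‖ ^ p :=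
    Summable.of_nonneg_of_le (fun _ => by positivity) hmax (hFsum.summable.mul_left 576)
  have hmem : Memℓp (smallDyadicMaximal d (fun x => f x)) (ENNReal.ofReal p) :=
    memℓp_gen (by rwa [hpr])
  refine ⟨hmem, lp.norm_le_of_tsum_le hpp (mul_nonneg (by positivity) hfn) ?_⟩
  rw [hpr]
  calc ∑' x, ‖smallDyadicMaximal d (fun x => f x) x‖ ^ p
      ≤ 576 * ‖F‖ ^ 2 := hasSum_le hmax hsum.hasSum (hFsum.mul_left 576)
    _ ≤ 576 * (4 * ‖g‖) ^ 2 := by gcongr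
    _ = 9216 * ‖f‖ ^ p := by rw [mul_pow, hgn]; ring
    -- `9216 = (24 * 4) ^ 2`, well below `30 ^ 4`, the `p`-th power of the claimed constant.
    _ ≤ 30 ^ 4 * ‖f‖ ^ p :=
      mul_le_mul_of_nonneg_right (by norm_num) (Real.rpow_nonneg hfn p)
    _ = _ := by
      rw [Real.mul_rpow (by positivity) hfn, ← Real.rpow_mul (by norm_num),
        div_mul_cancel₀ _ hp0.ne']
      norm_num
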